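/- Let $\Bbbk$ be a field, $P=\Bbbk[x_1,\dots,x_n]$ with its standard grading, and let $\operatorname{lt} f$ denote the leading term of $0\ne f\in P$ for the degree reverse lexicographic order with $x_1\succ\cdots\succ x_n$; for an ideal $I$, $\operatorname{lt} I$ is the monomial ideal generated by all $\operatorname{lt} f$, $0\neq f\in I$. The class $\operatorname{cls}(t)$ of a term $t\neq 1$ is the maximal index $c$ with $x_c\mid t$, and $\operatorname{cls}(1)=1$. A finite set $T$ of terms is a Pommaret basis of the monomial ideal $J$ it generates if $J=\bigoplus_{t\in T}\Bbbk[x_{\operatorname{cls}(t)},\dots,x_n]\cdot t$. A finite set $H$ of nonzero polynomials is a Pommaret basis of the ideal $I$ it generates if its elements have pairwise distinct leading terms and $\{\operatorname{lt} h : h\in H\}$ is a Pommaret basis of $\operatorname{lt} I$. For $M=P/I$ with $I$ homogeneous, a sequence $\mathbf y=(y_1,\dots,y_n)$ of linear forms and $0\le i<n$, put $A_i(\mathbf y;M)=0:_{M/\langle y_1,\dots,y_i\rangle M}\,y_{i+1}$, a graded module, and $\alpha_{ij}(\mathbf y;M)=\dim_{\Bbbk}A_i(\mathbf y;M)_j$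 for $j\ge 0$. The sequence $\mathbf y$ is called quasi-regular for $M$ if each $A_i(\mathbf y;M)$, $0\le i<n$, has only finitely many nonzero graded components. **Theorem.** Let the finite set $H$ be a Pommaret basis, for the degree reverse lexicographic order, of the homogeneous ideal $I\subseteq P$, and let $M=P/I$. Then the sequence $(x_n,\dots,x_1)$ is quasi-regular for $M$, and for all $0\le i<n$ and $j\ge0$ $$\alpha_{ij}(x_n,\dots,x_1;M)=\#\{h\in H : \operatorname{cls}(\operatorname{lt} h)=n-i \text{ and } \deg h=j+1\}.$$ -/

import Mathlib

noncomputable section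

namespace PommaretAnn

open MvPolynomial

/-! Variables are indexed by `Fin n`: the index `i : Fin n` stands for the variable `x_{i+1}`. -/

/-! ### The degree reverse lexicographic order -/

/-- Exponent vectors, to be equipped with the degree reverse lexicographic order. -/
def DegRevLex (n : ℕ) : Type := Fin n →₀ ℕ

instance (n : ℕ) : AddCommMonoid (DegRevLex n) := inferInstanceAs (AddCommMonoid (Fin n →₀ ℕ))

/-- The partial sums `(a₁ + ⋯ + aₙ, a₁ + ⋯ + aₙ₋₁, …, a₁)` of an exponent vector. The degree
reverse lexicographic order compares them lexicographically; see `degRevLex_lt_iff` for the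
usual description. -/
def partialSums (n : ℕ) : DegRevLex n →+ Lex (Fin n → ℕ) where
  toFun a := toLex fun l => ∑ i ∈ Finset.Iic (Fin.rev l), (show Fin n →₀ ℕ from a) i
  map_zero' := by
    apply toLex.symm.injective
    funext l
    exact Finset.sum_eq_zero fun _ _ => rfl
  map_add' a b := by
    apply toLex.symm.injective
    funext l
    exact Finset.sum_add_distrib

theorem partialSums_apply {n : ℕ} (a : Fin n →₀ ℕ) (l : Fin n) :
    ofLex (partialSums n a) l = ∑ i ∈ Finset.Iic (Fin.rev l), a i := rfl

theorem sum_Iic_eq {n : ℕ} (a : Fin n →₀ ℕ) (i : Fin n) :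
    ∑ j ∈ Finset.Iic i, a j + ∑ j ∈ Finset.Ioi i, a j = a.degree := by
  rw [Finsupp.degree_eq_sum, ← Finset.sum_union]
  · congr 1
    ext j
    simp [le_or_gt]
  · rw [Finset.disjoint_left]
    intro j
    simp

theorem partialSums_lt_of {n : ℕ} {a b : Fin n →₀ ℕ}
    (h : a.degree < b.degree ∨
      a.degree = b.degree ∧ ∃ i, (∀ j, i < j → a j = b j) ∧ b i < a i) :
    partialSums n a < partialSums n b := by
  rcases h with h | ⟨hd, i, hi, hlt⟩
  · rcases n with _ | n
    · simp [Finsupp.degree_eq_sum] at h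
    · refine ⟨0, fun j hj => absurd hj (Fin.not_lt_zero j), ?_⟩
      change ∑ i ∈ Finset.Iic (Fin.rev 0), a i < ∑ i ∈ Finset.Iic (Fin.rev 0), b i
      have ht : Finset.Ioi (Fin.rev (0 : Fin (n + 1))) = ∅ := by
        ext j
        simpa using Fin.le_last j
      have h1 := sum_Iic_eq a (Fin.rev 0)
      have h2 := sum_Iic_eq b (Fin.rev 0)
      rw [ht, Finset.sum_empty] at h1 h2
      omega
  · have hi0 : (i : ℕ) ≠ 0 := by
      intro h0
      have hle : ∀ j, b j ≤ a j := by
        intro j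
        rcases eq_or_ne j i with rfl | hj
        · exact hlt.le
        · exact (hi j (lt_of_le_of_ne (by rw [Fin.le_def]; omega) hj.symm)).ge
      have := Finset.sum_lt_sum (s := Finset.univ) (fun j _ => hle j) ⟨i, Finset.mem_univ i, hlt⟩
      rw [Finsupp.degree_eq_sum, Finsupp.degree_eq_sum] at hd
      omega
    obtain ⟨p, hp⟩ : ∃ p : Fin n, (p : ℕ) + 1 = i :=
      ⟨⟨(i : ℕ) - 1, by omega⟩, by simp only; omega⟩
    refine ⟨Fin.rev p, fun j hj => ?_, ?_⟩
    · change ∑ i ∈ Finset.Iic (Fin.rev j), a i = ∑ i ∈ Finset.Iic (Fin.rev j), b i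
      have hj' : p < Fin.rev j := by
        rw [← Fin.rev_lt_rev, Fin.rev_rev]
        exact hj
      have h1 := sum_Iic_eq a (Fin.rev j)
      have h2 := sum_Iic_eq b (Fin.rev j)
      have ht : ∑ l ∈ Finset.Ioi (Fin.rev j), a l = ∑ l ∈ Finset.Ioi (Fin.rev j), b l := by
        refine Finset.sum_congr rfl fun l hl => hi l ?_
        rw [Finset.mem_Ioi] at hl
        rw [Fin.lt_def] at hl hj' ⊢
        omega
      omega
    · change ∑ i ∈ Finset.Iic (Fin.rev (Fin.rev p)), a i <
        ∑ i ∈ Finset.Iic (Fin.rev (Fin.rev p)), b i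
      rw [Fin.rev_rev]
      have h1 := sum_Iic_eq a p
      have h2 := sum_Iic_eq b p
      have ht : ∑ l ∈ Finset.Ioi p, b l < ∑ l ∈ Finset.Ioi p, a l := by
        refine Finset.sum_lt_sum (fun l hl => ?_) ⟨i, ?_, hlt⟩
        · rcases eq_or_ne l i with rfl | hl'
          · exact hlt.le
          · rw [Finset.mem_Ioi, Fin.lt_def] at hl
            refine (hi l (lt_of_le_of_ne ?_ hl'.symm)).ge
            rw [Fin.le_def]
            omega
        · rw [Finset.mem_Ioi, Fin.lt_def]
          omega
      omega

theorem degRevLex_trichotomy {n : ℕ} (a b : Fin n →₀ ℕ) :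
    (a.degree < b.degree ∨
      a.degree = b.degree ∧ ∃ i, (∀ j, i < j → a j = b j) ∧ b i < a i) ∨ a = b ∨
    (b.degree < a.degree ∨
      b.degree = a.degree ∧ ∃ i, (∀ j, i < j → b j = a j) ∧ a i < b i) := by
  rcases lt_trichotomy a.degree b.degree with h | h | h
  · exact Or.inl (Or.inl h)
  · by_cases hab : a = b
    · exact Or.inr (Or.inl hab)
    · have hne : (Finset.univ.filter fun i => a i ≠ b i).Nonempty := by
        by_contra hc
        rw [Finset.not_nonempty_iff_eq_empty, Finset.filter_eq_empty_iff] at hc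
        exact hab (Finsupp.ext fun i => not_not.mp (hc (Finset.mem_univ i)))
      obtain ⟨i, hi, hmax⟩ := Finset.exists_maximal hne
      rw [Finset.mem_filter] at hi
      have heq : ∀ j, i < j → a j = b j := by
        intro j hj
        by_contra hc
        exact absurd (hmax (Finset.mem_filter.mpr ⟨Finset.mem_univ j, hc⟩) hj.le) (not_le.mpr hj)
      rcases lt_or_gt_of_ne hi.2 with hl | hl
      · exact Or.inr (Or.inr (Or.inr ⟨h.symm, i, fun j hj => (heq j hj).symm, hl⟩))
      · exact Or.inl (Or.inr ⟨h, i, heq, hl⟩)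
  · exact Or.inr (Or.inr (Or.inl h))

theorem partialSums_lt_iff {n : ℕ} (a b : Fin n →₀ ℕ) :
    partialSums n a < partialSums n b ↔
      a.degree < b.degree ∨
        a.degree = b.degree ∧ ∃ i, (∀ j, i < j → a j = b j) ∧ b i < a i := by
  refine ⟨fun h => ?_, partialSums_lt_of⟩
  rcases degRevLex_trichotomy a b with h' | rfl | h'
  · exact h'
  · exact absurd h (lt_irrefl _)
  · exact absurd h (partialSums_lt_of h').asymm

theorem partialSums_injective (n : ℕ) : Function.Injective (partialSums n) := by
  intro a b h
  rcases degRevLex_trichotomy (n := n) a b with h' | h' | h'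
  · exact absurd h (partialSums_lt_of h').ne
  · exact h'
  · exact absurd h (partialSums_lt_of h').ne'

instance (n : ℕ) : LinearOrder (DegRevLex n) :=
  LinearOrder.lift' (partialSums n) (partialSums_injective n)

instance (n : ℕ) : IsOrderedCancelAddMonoid (DegRevLex n) :=
  Function.Injective.isOrderedCancelAddMonoid (partialSums n) (map_add _) Iff.rfl

instance (n : ℕ) : WellFoundedLT (DegRevLex n) :=
  ⟨InvImage.wf (partialSums n) wellFounded_lt⟩

/-- The degree reverse lexicographic monomial order with `x₁ ≻ x₂ ≻ ⋯ ≻ xₙ`. -/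
def degRevLex (n : ℕ) : MonomialOrder (Fin n) where
  syn := DegRevLex n
  toSyn := AddEquiv.refl _
  toSyn_monotone := by
    intro a b h
    change partialSums n a ≤ partialSums n b
    exact Pi.toLex_monotone fun l => Finset.sum_le_sum fun i _ => h i

open scoped MonomialOrder in
/-- The usual description: `x^a ≺ x^b` iff `deg a < deg b`, or the degrees are equal and the
last nonzero entry of `b - a` is negative. -/
theorem degRevLex_lt_iff {n : ℕ} (a b : Fin n →₀ ℕ) :
    a ≺[degRevLex n] b ↔
      a.degree < b.degree ∨
        a.degree = b.degree ∧ ∃ i, (∀ j, i < j → a j = b j) ∧ b i < a i :=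
  partialSums_lt_iff a b

/-! ### Pommaret bases -/

section Pommaret

variable {k : Type*} [Field k] {n : ℕ}

/-- The class of the term `x^μ`: the maximal (one-based) index of a variable occurring in it,
with the convention that the class of `1` is `1`. -/
def cls (μ : Fin n →₀ ℕ) : ℕ := max 1 (μ.support.sup fun i => (i : ℕ) + 1)

/-- The (indices of the) Pommaret multiplicative variables `x_c, …, x_n` of a term of
class `c`. -/
def multVars (μ : Fin n →₀ ℕ) : Set (Fin n) := {i | cls μ ≤ (i : ℕ) + 1}

/-- The involutive cone `k[mult(x^μ)] · x^μ`, a `k`-linear subspace of the polynomial ring. -/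
def cone (k : Type*) [Field k] (μ : Fin n →₀ ℕ) : Submodule k (MvPolynomial (Fin n) k) :=
  (Subalgebra.toSubmodule (supported k (multVars μ))).map
    (LinearMap.mulRight k (monomial μ (1 : k)))

/-- A finite set `T` of terms (given by exponent vectors) is a Pommaret basis of the monomial
ideal `J` if it generates `J` and `J` is the direct sum of the involutive cones
`k[mult(t)] · t`, `t ∈ T`. -/
structure IsMonomialPommaretBasis (T : Finset (Fin n →₀ ℕ))
    (J : Ideal (MvPolynomial (Fin n) k)) : Prop where
  span_eq : Ideal.span ((fun t => monomial t (1 : k)) '' (T : Set (Fin n →₀ ℕ))) = J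
  independent : iSupIndep fun t : T => cone k (t : Fin n →₀ ℕ)
  iSup_eq : ⨆ t : T, cone k (t : Fin n →₀ ℕ) = J.restrictScalars k

/-- The leading exponent of a polynomial for the degree reverse lexicographic order. -/
abbrev lt (f : MvPolynomial (Fin n) k) : Fin n →₀ ℕ := (degRevLex n).degree f

/-- The leading ideal: the ideal generated by the leading terms of the nonzero elements. -/
def leadingIdeal (I : Ideal (MvPolynomial (Fin n) k)) : Ideal (MvPolynomial (Fin n) k) :=
  Ideal.span ((fun f => monomial (lt f) (1 : k)) '' {f | f ∈ I ∧ f ≠ 0})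

/-- A finite set `H` of (nonzero) polynomials is a Pommaret basis of `I` for the degree reverse
lexicographic order if it generates `I`, its elements have pairwise distinct leading terms, and
these leading terms form a Pommaret basis of the leading ideal of `I`. -/
structure IsPommaretBasis (H : Finset (MvPolynomial (Fin n) k))
    (I : Ideal (MvPolynomial (Fin n) k)) : Prop where
  zero_notMem : (0 : MvPolynomial (Fin n) k) ∉ H
  span_eq : Ideal.span (H : Set (MvPolynomial (Fin n) k)) = I
  lt_injOn : Set.InjOn lt (H : Set (MvPolynomial (Fin n) k))
  lt_basis : IsMonomialPommaretBasis (H.image lt) (leadingIdeal I)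

/-! ### Annihilator numbers -/

/-- For a sequence `y = (y_1, …, y_m)` and `M = P/I`, the module `M / ⟨y_1, …, y_i⟩ M`
(in the zero-based indexing of `Fin m`, these are the `y l` with `l < i`). -/
abbrev SeqQuotient (I : Ideal (MvPolynomial (Fin n) k)) {m : ℕ}
    (y : Fin m → MvPolynomial (Fin n) k) (i : Fin m) : Type _ :=
  (MvPolynomial (Fin n) k ⧸ I) ⧸
    (Ideal.span (y '' Set.Iio i) •
      (⊤ : Submodule (MvPolynomial (Fin n) k) (MvPolynomial (Fin n) k ⧸ I)))

/-- The annihilator `A_i(y; P/I) = 0 :_{M / ⟨y_1, …, y_i⟩ M} y_{i+1}`. -/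
def annModule (I : Ideal (MvPolynomial (Fin n) k)) {m : ℕ}
    (y : Fin m → MvPolynomial (Fin n) k) (i : Fin m) :
    Submodule (MvPolynomial (Fin n) k) (SeqQuotient I y i) :=
  Submodule.torsionBy (MvPolynomial (Fin n) k) (SeqQuotient I y i) (y i)

/-- The homogeneous component of degree `j` of `M / ⟨y_1, …, y_i⟩ M`, for the grading induced
by the standard grading of the polynomial ring. -/
def seqQuotientComponent (I : Ideal (MvPolynomial (Fin n) k)) {m : ℕ}
    (y : Fin m → MvPolynomial (Fin n) k) (i : Fin m) (j : ℕ) :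
    Submodule k (SeqQuotient I y i) :=
  (homogeneousSubmodule (Fin n) k j).map
    (((Submodule.mkQ (Ideal.span (y '' Set.Iio i) •
        (⊤ : Submodule (MvPolynomial (Fin n) k) (MvPolynomial (Fin n) k ⧸ I)))).comp
      (Submodule.mkQ I)).restrictScalars k)

/-- The homogeneous component of degree `j` of `A_i(y; P/I)`. -/
def annComponent (I : Ideal (MvPolynomial (Fin n) k)) {m : ℕ}
    (y : Fin m → MvPolynomial (Fin n) k) (i : Fin m) (j : ℕ) :
    Submodule k (SeqQuotient I y i) :=
  (annModule I y i).restrictScalars k ⊓ seqQuotientComponent I y i j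

/-- The sequence `y` of linear forms is quasi-regular for `P/I`: each annihilator
`A_i(y; P/I)` has only finitely many nonzero homogeneous components. -/
def IsQuasiRegular (I : Ideal (MvPolynomial (Fin n) k)) {m : ℕ}
    (y : Fin m → MvPolynomial (Fin n) k) : Prop :=
  (∀ i, (y i).IsHomogeneous 1) ∧ ∀ i, {j : ℕ | annComponent I y i j ≠ ⊥}.Finite

/-- The annihilator number `α_{ij}(y; P/I) = dim_k A_i(y; P/I)_j`. -/
def annihilatorNumber (I : Ideal (MvPolynomial (Fin n) k)) {m : ℕ}
    (y : Fin m → MvPolynomial (Fin n) k) (i : Fin m) (j : ℕ) : ℕ :=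
  Module.finrank k (annComponent I y i j)

/-- The sequence `(x_n, …, x_2, x_1)`. -/
def reversedVars (k : Type*) [Field k] (n : ℕ) : Fin n → MvPolynomial (Fin n) k :=
  fun i => X (Fin.rev i)

end Pommaret

end PommaretAnn

end

attribute [local instance] MvPolynomial.gradedAlgebra

namespace PommaretAnn

open MvPolynomial
open scoped MonomialOrder

section

variable {k : Type*} [Field k] {n : ℕ}

/-! ### Leading exponents -/

/-! Put c = n - i. The module containing A_i is the quotient Q of P by I and the variables after
x_c. In the degree reverse lexicographic order, monomials involving those variables are smaller than
all others of the same degree. Hence the standard monomials of I in x_1, …, x_c give a basis of Q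
(`map_monomial_mem_span_standard`, `linearIndepOn_standard`).

The image of Q_j under x_c is spanned by the classes of degree j+1 monomials divisible by x_c or a
later variable. These monomials are closed under passing to smaller ones of the same degree, so
reduction stays among them, and the image has as basis the standard ones
(`finrank_map_restrictSupport`). Rank-nullity and division by x_c then show that α_ij counts the
standard s of degree j in x_1, …, x_c with x_c s nonstandard (`ncard_standard_eq_add`). By
uniqueness of involutive divisors, such x_c s are exactly the Pommaret generators of class c and
degree j+1 (`notMem_and_add_single_mem_iff`). Finiteness of H leaves only finitely many j, which is
quasi-regularity. -/

/-- The exponents of the monomials in the leading ideal. -/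
def leadingExponents (I : Ideal (MvPolynomial (Fin n) k)) : Set (Fin n →₀ ℕ) :=
  {μ | monomial μ (1 : k) ∈ leadingIdeal I}

theorem mem_leadingExponents_iff {I : Ideal (MvPolynomial (Fin n) k)} {μ : Fin n →₀ ℕ} :
    μ ∈ leadingExponents I ↔ ∃ f ∈ I, f ≠ 0 ∧ lt f ≤ μ := by
  have h : leadingIdeal I =
      Ideal.span ((fun s => monomial s (1 : k)) '' (lt '' {f | f ∈ I ∧ f ≠ 0})) := by
    rw [Set.image_image]
    rfl
  rw [leadingExponents, Set.mem_ofPred_eq, h, mem_ideal_span_monomial_image]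
  simp [and_assoc]

theorem leadingExponents_of_le {I : Ideal (MvPolynomial (Fin n) k)} {μ ν : Fin n →₀ ℕ}
    (hμ : μ ∈ leadingExponents I) (h : μ ≤ ν) : ν ∈ leadingExponents I := by
  rw [mem_leadingExponents_iff] at hμ ⊢
  obtain ⟨f, hf, h0, hle⟩ := hμ
  exact ⟨f, hf, h0, hle.trans h⟩

theorem homogeneousComponent_mem {I : Ideal (MvPolynomial (Fin n) k)}
    (hI : I.IsHomogeneous (homogeneousSubmodule (Fin n) k)) {f : MvPolynomial (Fin n) k}
    (hf : f ∈ I) (j : ℕ) : homogeneousComponent j f ∈ I := by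
  have := hI j hf
  rwa [← decomposition.decompose'_apply]

theorem degree_le_of_degRevLex_le {μ ν : Fin n →₀ ℕ} (h : μ ≼[degRevLex n] ν) :
    μ.degree ≤ ν.degree := by
  rcases lt_or_eq_of_le h with h | h
  · rcases (degRevLex_lt_iff μ ν).1 h with h | h
    · exact h.le
    · exact h.1.le
  · rw [(degRevLex n).toSyn.injective h]

theorem totalDegree_eq_degree_lt (f : MvPolynomial (Fin n) k) :
    f.totalDegree = (lt f).degree := by
  rcases eq_or_ne f 0 with rfl | hf
  · simp [lt]
  · apply le_antisymm
    · refine Finset.sup_le fun μ hμ => ?_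
      exact degree_le_of_degRevLex_le ((degRevLex n).le_degree hμ)
    · exact le_totalDegree ((degRevLex n).degree_mem_support hf)

/-- Each leading exponent is that of a monic homogeneous element, all of whose other terms are
smaller. -/
theorem exists_reducer {I : Ideal (MvPolynomial (Fin n) k)}
    (hI : I.IsHomogeneous (homogeneousSubmodule (Fin n) k)) {μ : Fin n →₀ ℕ}
    (hμ : μ ∈ leadingExponents I) :
    ∃ g : MvPolynomial (Fin n) k, monomial μ 1 - g ∈ I ∧
      ∀ ν ∈ g.support, ν.degree = μ.degree ∧ ν ≺[degRevLex n] μ := by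
  obtain ⟨f, hf, h0, hle⟩ := mem_leadingExponents_iff.1 hμ
  have hlc : (degRevLex n).leadingCoeff f ≠ 0 := (degRevLex n).leadingCoeff_ne_zero_iff.2 h0
  set q := monomial (μ - lt f) ((degRevLex n).leadingCoeff f)⁻¹ with hq
  have hadd : μ - lt f + lt f = μ := tsub_add_cancel_of_le hle
  -- The factor q shifts the leading exponent of f to μ and makes it monic; the component of degree
  -- |μ| keeps that term and stays in I by homogeneity.
  set p := homogeneousComponent μ.degree (q * f) with hp
  have hpI : p ∈ I := homogeneousComponent_mem hI (I.mul_mem_left _ hf) _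
  have hcoeff : coeff μ p = 1 := by
    rw [hp, coeff_homogeneousComponent, if_pos rfl]
    nth_rw 1 [← hadd]
    rw [hq, coeff_monomial_mul]
    exact inv_mul_cancel₀ hlc
  have hsupp : ∀ ν ∈ p.support, ν.degree = μ.degree ∧ ν ≼[degRevLex n] μ := by
    intro ν hν
    rw [mem_support_iff, hp, coeff_homogeneousComponent] at hν
    have hd : ν.degree = μ.degree := by
      by_contra h
      simp [h] at hν
    rw [if_pos hd] at hν
    refine ⟨hd, ((degRevLex n).le_degree (mem_support_iff.2 hν)).trans ?_⟩
    calc (degRevLex n).toSyn ((degRevLex n).degree (q * f))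
        ≤ (degRevLex n).toSyn ((degRevLex n).degree q + (degRevLex n).degree f) :=
          (degRevLex n).degree_mul_le
      _ ≤ (degRevLex n).toSyn (μ - lt f + lt f) := by
          rw [map_add, map_add]
          exact add_le_add_left ((degRevLex n).degree_monomial_le _) _
      _ = (degRevLex n).toSyn μ := by rw [hadd]
  refine ⟨monomial μ 1 - p, by simpa using hpI, fun ν hν => ?_⟩
  have hne : ν ≠ μ := by
    rintro rfl
    simp [hcoeff] at hν
  have hν' : ν ∈ p.support := by
    rw [mem_support_iff, coeff_sub, coeff_monomial, if_neg hne.symm] at hν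
    simpa using hν
  exact ⟨(hsupp ν hν').1, lt_of_le_of_ne (hsupp ν hν').2
    fun h => hne ((degRevLex n).toSyn.injective h)⟩

/-- Among monomials of the same degree, those not involving the last variables are larger. -/
theorem degRevLex_lt_of_trailing {μ ν : Fin n →₀ ℕ} {m : ℕ} (hd : ν.degree = μ.degree)
    (hμ : ∀ l : Fin n, m ≤ l → μ l = 0) (hν : ∃ l : Fin n, m ≤ l ∧ ν l ≠ 0) :
    ν ≺[degRevLex n] μ := by
  rw [degRevLex_lt_iff]
  refine Or.inr ⟨hd, ?_⟩
  have hne : (Finset.univ.filter fun l : Fin n => m ≤ l ∧ ν l ≠ 0).Nonempty := by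
    obtain ⟨l, hl⟩ := hν
    exact ⟨l, by simpa using hl⟩
  have hmem := Finset.max'_mem _ hne
  simp only [Finset.mem_filter, Finset.mem_univ, true_and] at hmem
  -- At the last trailing index where ν is nonzero, μ vanishes; beyond it both vanish.
  refine ⟨Finset.max' _ hne, fun j hj => ?_, ?_⟩
  rotate_left
  · rw [hμ _ hmem.1]
    exact Nat.pos_of_ne_zero hmem.2
  · have hmj : m ≤ (j : ℕ) := hmem.1.trans (Fin.le_def.1 hj.le)
    rw [hμ j hmj]
    by_contra h
    exact absurd (Finset.le_max' _ j (by simpa using ⟨hmj, h⟩)) (not_le.2 hj)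

/-! ### Standard monomials -/

/-- The exponents of the standard monomials in the first `m` variables. -/
def standardExponents (I : Ideal (MvPolynomial (Fin n) k)) (m : ℕ) : Set (Fin n →₀ ℕ) :=
  {μ | (∀ l : Fin n, m ≤ l → μ l = 0) ∧ μ ∉ leadingExponents I}

/-- The ideal generated by `I` and the variables from the index `m` on. -/
noncomputable def trailingIdeal (I : Ideal (MvPolynomial (Fin n) k)) (m : ℕ) :
    Ideal (MvPolynomial (Fin n) k) :=
  I ⊔ Ideal.span (X '' {l : Fin n | m ≤ l})

theorem monomial_mem_trailingIdeal (I : Ideal (MvPolynomial (Fin n) k)) {m : ℕ}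
    {μ : Fin n →₀ ℕ} (h : ∃ l : Fin n, m ≤ l ∧ μ l ≠ 0) (c : k) :
    monomial μ c ∈ trailingIdeal I m := by
  refine Ideal.mem_sup_right ?_
  rw [mem_ideal_span_X_image]
  intro ν hν
  rw [Finset.mem_singleton.1 (support_monomial_subset hν)]
  exact h

/-- Write g = f + h with f in I and h in the ideal of the trailing variables. The leading term of g
avoids those variables, so it comes from f, and it even leads the degree j component of f. It would
thus be both standard and a leading exponent of I. -/
theorem eq_zero_of_mem_trailingIdeal {I : Ideal (MvPolynomial (Fin n) k)}
    (hI : I.IsHomogeneous (homogeneousSubmodule (Fin n) k)) {m j : ℕ}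
    {g : MvPolynomial (Fin n) k} (hg : g ∈ trailingIdeal I m)
    (hs : ∀ μ ∈ g.support, μ.degree = j ∧ μ ∈ standardExponents I m) : g = 0 := by
  by_contra h0
  obtain ⟨f, hf, h, hh, rfl⟩ := Submodule.mem_sup.1 hg
  rw [mem_ideal_span_X_image] at hh
  have hμ := (degRevLex n).degree_mem_support h0
  set μ := (degRevLex n).degree (f + h) with hμdef
  obtain ⟨hd, hμ0, hμI⟩ := hs μ hμ
  have hhμ : coeff μ h = 0 := by
    by_contra hc
    obtain ⟨l, hl, hne⟩ := hh μ (mem_support_iff.2 hc)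
    exact hne (hμ0 l hl)
  have hfμ : coeff μ (homogeneousComponent j f) ≠ 0 := by
    rw [coeff_homogeneousComponent, if_pos hd]
    simpa [hhμ] using hμ
  refine hμI (mem_leadingExponents_iff.2 ⟨homogeneousComponent j f,
    homogeneousComponent_mem hI hf j, fun h => hfμ (by simp [h]), le_of_eq ?_⟩)
  apply (degRevLex n).toSyn.injective
  refine le_antisymm ?_ ((degRevLex n).le_degree (mem_support_iff.2 hfμ))
  rw [(degRevLex n).degree_le_iff]
  intro ν hν
  rw [mem_support_iff, coeff_homogeneousComponent] at hν
  have hνd : ν.degree = j := by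
    by_contra h
    simp [h] at hν
  rw [if_pos hνd] at hν
  by_cases hνs : ν ∈ (f + h).support
  · exact (degRevLex n).le_degree hνs
  -- A term of f missing from the sum was cancelled by h, so it involves a trailing variable and is
  -- smaller than μ.
  · refine (degRevLex_lt_of_trailing (hνd.trans hd.symm) hμ0 (hh ν ?_)).le
    rw [mem_support_iff]
    intro hc
    apply hνs
    rw [mem_support_iff, coeff_add, hc, add_zero]
    exact hν

variable {W : Type*} [AddCommGroup W] [Module k W]

/-- Normal form reduction by well-founded induction: a nonstandard monomial is replaced by smaller
ones of the same degree, which remain in E because E is closed downwards within each degree. -/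
theorem map_monomial_mem_span_standard {I : Ideal (MvPolynomial (Fin n) k)}
    (hI : I.IsHomogeneous (homogeneousSubmodule (Fin n) k)) {m : ℕ}
    (π : MvPolynomial (Fin n) k →ₗ[k] W) (hπ : ∀ f, π f = 0 ↔ f ∈ trailingIdeal I m)
    {E : Set (Fin n →₀ ℕ)}
    (hE : ∀ μ ∈ E, ∀ ν : Fin n →₀ ℕ, ν.degree = μ.degree → ν ≺[degRevLex n] μ → ν ∈ E)
    (μ : Fin n →₀ ℕ) (hμ : μ ∈ E) :
    π (monomial μ 1) ∈
      Submodule.span k ((fun ν => π (monomial ν 1)) '' (E ∩ standardExponents I m)) := by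
  induction hs : (degRevLex n).toSyn μ using WellFoundedLT.induction generalizing μ with
  | ind a ih =>
    subst hs
    by_cases hl : ∃ l : Fin n, m ≤ l ∧ μ l ≠ 0
    · rw [(hπ _).2 (monomial_mem_trailingIdeal I hl 1)]
      exact Submodule.zero_mem _
    · push Not at hl
      by_cases hlead : μ ∈ leadingExponents I
      · obtain ⟨g, hg, hgs⟩ := exists_reducer hI hlead
        have h0 : π (monomial μ 1) = π g := by
          rw [← sub_eq_zero, ← map_sub, hπ]
          exact Ideal.mem_sup_left hg
        rw [h0, g.as_sum, map_sum]
        refine Submodule.sum_mem _ fun ν hν => ?_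
        obtain ⟨hd, hlt⟩ := hgs ν hν
        have hc : monomial ν (coeff ν g) = coeff ν g • monomial ν (1 : k) := by
          simp [smul_monomial]
        rw [hc, map_smul]
        exact Submodule.smul_mem _ _ (ih _ hlt ν (hE μ hμ ν hd hlt) rfl)
      · exact Submodule.subset_span ⟨μ, ⟨hμ, hl, hlead⟩, rfl⟩

theorem linearIndepOn_standard {I : Ideal (MvPolynomial (Fin n) k)}
    (hI : I.IsHomogeneous (homogeneousSubmodule (Fin n) k)) {m j : ℕ}
    (π : MvPolynomial (Fin n) k →ₗ[k] W) (hπ : ∀ f, π f = 0 ↔ f ∈ trailingIdeal I m)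
    {S : Set (Fin n →₀ ℕ)} (hS : S ⊆ standardExponents I m) (hj : ∀ μ ∈ S, μ.degree = j) :
    LinearIndepOn k (fun ν => π (monomial ν 1)) S := by
  have hb : LinearIndependent k fun ν : S => monomial (R := k) (ν : Fin n →₀ ℕ) 1 := by
    have := (basisMonomials (Fin n) k).linearIndependent
    rw [coe_basisMonomials] at this
    exact this.comp _ Subtype.val_injective
  refine hb.map (f := π) ?_
  rw [Submodule.disjoint_def]
  intro g hg hker
  have hg' : g ∈ restrictSupport k S := by
    rw [restrictSupport_eq_span, Set.image_eq_range]
    exact hg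
  rw [mem_restrictSupport_iff] at hg'
  exact eq_zero_of_mem_trailingIdeal hI ((hπ g).1 hker) fun μ hμ => ⟨hj μ (hg' hμ), hS (hg' hμ)⟩

/-- The dimension of the image of a space spanned by monomials of degree `j`, the exponents of
which form a lower set for the degree reverse lexicographic order. -/
theorem finrank_map_restrictSupport {I : Ideal (MvPolynomial (Fin n) k)}
    (hI : I.IsHomogeneous (homogeneousSubmodule (Fin n) k)) {m j : ℕ}
    (π : MvPolynomial (Fin n) k →ₗ[k] W) (hπ : ∀ f, π f = 0 ↔ f ∈ trailingIdeal I m)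
    {E : Set (Fin n →₀ ℕ)} (hj : ∀ μ ∈ E, μ.degree = j)
    (hE : ∀ μ ∈ E, ∀ ν : Fin n →₀ ℕ, ν.degree = μ.degree → ν ≺[degRevLex n] μ → ν ∈ E) :
    Module.finrank k ((restrictSupport k E).map π) = (E ∩ standardExponents I m).ncard := by
  have hspan : (restrictSupport k E).map π =
      Submodule.span k ((fun ν => π (monomial ν 1)) '' (E ∩ standardExponents I m)) := by
    rw [restrictSupport_eq_span, Submodule.map_span, Set.image_image]
    apply le_antisymm
    · rw [Submodule.span_le]
      rintro _ ⟨μ, hμ, rfl⟩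
      exact map_monomial_mem_span_standard hI π hπ hE μ hμ
    · exact Submodule.span_mono (Set.image_mono Set.inter_subset_left)
  have hli := linearIndepOn_standard hI π hπ (S := E ∩ standardExponents I m)
    Set.inter_subset_right fun μ hμ => hj μ hμ.1
  have hfin : (E ∩ standardExponents I m).Finite :=
    (Finsupp.finite_of_degree_eq j).subset fun μ hμ => hj μ hμ.1
  have := hfin.fintype
  rw [hspan, Set.image_eq_range, ← Nat.card_coe_set_eq, Nat.card_eq_fintype_card]
  exact finrank_span_eq_card hli

end

end PommaretAnn

namespace PommaretAnn

open MvPolynomial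
open scoped MonomialOrder

section

variable {k : Type*} [Field k] {n : ℕ}

/-! ### Involutive cones -/

/-- The exponents of the monomials in the involutive cone of `x^t`. -/
def coneExponents (t : Fin n →₀ ℕ) : Set (Fin n →₀ ℕ) :=
  {ν | t ≤ ν ∧ ∀ l ∉ multVars t, ν l = t l}

theorem self_mem_coneExponents (t : Fin n →₀ ℕ) : t ∈ coneExponents t :=
  ⟨le_rfl, fun _ _ => rfl⟩

theorem cone_le_restrictSupport (t : Fin n →₀ ℕ) :
    cone k t ≤ restrictSupport k (coneExponents t) := by
  rintro _ ⟨p, hp, rfl⟩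
  rw [SetLike.mem_coe, Subalgebra.mem_toSubmodule, mem_supported] at hp
  rw [mem_restrictSupport_iff]
  intro ν hν
  rw [Finset.mem_coe, mem_support_iff, LinearMap.mulRight_apply, coeff_mul_monomial'] at hν
  have hle : t ≤ ν := by
    by_contra h
    simp [h] at hν
  rw [if_pos hle, mul_one] at hν
  refine ⟨hle, fun l hl => ?_⟩
  by_contra hne
  refine hl (hp ((mem_vars_iff_mem_support l).2 ⟨ν - t, mem_support_iff.2 hν, ?_⟩))
  have := hle l
  rw [Finsupp.mem_support_iff, Finsupp.tsub_apply]
  omega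

theorem monomial_mem_cone {t ν : Fin n →₀ ℕ} (h : ν ∈ coneExponents t) :
    monomial ν (1 : k) ∈ cone k t := by
  refine ⟨monomial (ν - t) 1, ?_, ?_⟩
  · rw [SetLike.mem_coe, Subalgebra.mem_toSubmodule, mem_supported, vars_monomial one_ne_zero]
    intro l hl
    by_contra hlm
    rw [Finset.mem_coe, Finsupp.mem_support_iff, Finsupp.tsub_apply, h.2 l hlm] at hl
    exact hl (Nat.sub_self _)
  · rw [LinearMap.mulRight_apply, monomial_mul, tsub_add_cancel_of_le h.1, mul_one]

/-- Cones are spanned by monomials, so a monomial in their sum already lies in one of them. -/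
theorem IsMonomialPommaretBasis.monomial_mem_iff {T : Finset (Fin n →₀ ℕ)}
    {J : Ideal (MvPolynomial (Fin n) k)} (hT : IsMonomialPommaretBasis T J) (μ : Fin n →₀ ℕ) :
    monomial μ (1 : k) ∈ J ↔ ∃ t ∈ T, μ ∈ coneExponents t := by
  rw [← Submodule.restrictScalars_mem k, ← hT.iSup_eq]
  constructor
  · intro h
    have hle : ⨆ t : T, cone k (t : Fin n →₀ ℕ) ≤
        restrictSupport k (⋃ t : T, coneExponents (t : Fin n →₀ ℕ)) :=
      iSup_le fun t => (cone_le_restrictSupport _).trans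
        (restrictSupport_mono k (Set.subset_iUnion (fun t : T => coneExponents t.1) t))
    have := hle h
    rw [monomial_mem_restrictSupport] at this
    simpa using this
  · rintro ⟨t, ht, h⟩
    exact Submodule.mem_iSup_of_mem (⟨t, ht⟩ : T) (monomial_mem_cone h)

theorem IsMonomialPommaretBasis.eq_of_mem_coneExponents {T : Finset (Fin n →₀ ℕ)}
    {J : Ideal (MvPolynomial (Fin n) k)} (hT : IsMonomialPommaretBasis T J)
    {t t' μ : Fin n →₀ ℕ} (ht : t ∈ T) (ht' : t' ∈ T) (h : μ ∈ coneExponents t)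
    (h' : μ ∈ coneExponents t') : t = t' := by
  by_contra hne
  have hd := hT.independent.pairwiseDisjoint
    (show (⟨t, ht⟩ : T) ≠ ⟨t', ht'⟩ from fun h => hne (congrArg Subtype.val h))
  have := Submodule.disjoint_def.1 hd _ (monomial_mem_cone (k := k) h) (monomial_mem_cone h')
  exact one_ne_zero (monomial_eq_zero.1 this)

/-! ### Classes -/

theorem cls_le_iff {μ : Fin n →₀ ℕ} {c : Fin n} :
    cls μ ≤ c + 1 ↔ ∀ l : Fin n, (c : ℕ) + 1 ≤ l → μ l = 0 := by
  rw [cls, max_le_iff, Finset.sup_le_iff]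
  constructor
  · rintro ⟨-, h⟩ l hl
    by_contra hne
    have := h l (Finsupp.mem_support_iff.2 hne)
    omega
  · intro h
    refine ⟨by omega, fun l hl => ?_⟩
    by_contra hlt
    exact Finsupp.mem_support_iff.1 hl (h l (by omega))

theorem le_cls {μ : Fin n →₀ ℕ} {l : Fin n} (h : μ l ≠ 0) : (l : ℕ) + 1 ≤ cls μ :=
  le_max_of_le_right
    (Finset.le_sup (f := fun i : Fin n => (i : ℕ) + 1) (Finsupp.mem_support_iff.2 h))

/-- The term 1 must be excluded, since its class is 1 by convention only. -/
theorem apply_ne_zero_of_cls_eq {μ : Fin n →₀ ℕ} {c : Fin n} (h : cls μ = c + 1) (h0 : μ ≠ 0) :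
    μ c ≠ 0 := by
  intro hc
  obtain ⟨l, hl⟩ := Finsupp.support_nonempty_iff.2 h0
  rw [Finsupp.mem_support_iff] at hl
  obtain ⟨p, hp, hp'⟩ := Finset.exists_mem_eq_sup μ.support ⟨l, Finsupp.mem_support_iff.2 hl⟩
    (fun i : Fin n => (i : ℕ) + 1)
  rw [Finsupp.mem_support_iff] at hp
  rw [cls, hp'] at h
  have : p = c := Fin.ext (by omega)
  exact hp (this ▸ hc)

/-! ### Counting standard monomials -/

variable {I : Ideal (MvPolynomial (Fin n) k)} {T : Finset (Fin n →₀ ℕ)}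

/-- The monomials in `x_1, …, x_c` which are standard, but not after multiplication by `x_c`,
correspond to the elements of class `c` in the Pommaret basis. -/
theorem notMem_and_add_single_mem_iff (hT : IsMonomialPommaretBasis T (leadingIdeal I))
    {c : Fin n} {s : Fin n →₀ ℕ} (hs : ∀ l : Fin n, (c : ℕ) + 1 ≤ l → s l = 0) :
    s ∉ leadingExponents I ∧ s + Finsupp.single c 1 ∈ leadingExponents I ↔
      s + Finsupp.single c 1 ∈ T := by
  have hmem : ∀ μ, μ ∈ leadingExponents I ↔ ∃ t ∈ T, μ ∈ coneExponents t :=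
    hT.monomial_mem_iff
  have hne : ∀ l, l ≠ c → (s + Finsupp.single c 1 : Fin n →₀ ℕ) l = s l := fun l hl => by
    simp [Finsupp.single_eq_of_ne hl]
  have hc1 : (s + Finsupp.single c 1 : Fin n →₀ ℕ) c = s c + 1 := by simp
  have hsc : ∀ l : Fin n, (c : ℕ) + 1 ≤ l → (s + Finsupp.single c 1 : Fin n →₀ ℕ) l = 0 := fun l hl => by
    rw [hne l (by rintro rfl; omega), hs l hl]
  -- Divisors of x_c s have class at most that of x_c, so x_c is multiplicative for them.
  have hcm : ∀ t : Fin n →₀ ℕ, t ≤ s + Finsupp.single c 1 → c ∈ multVars t := fun t ht =>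
    cls_le_iff.2 fun l hl => Nat.le_zero.1 ((ht l).trans (hsc l hl).le)
  constructor
  · rintro ⟨h1, h2⟩
    obtain ⟨t, ht, htc⟩ := (hmem _).1 h2
    -- Otherwise t would already divide s involutively, making s nonstandard.
    have hlt : s c < t c := by
      by_contra hle
      refine h1 ((hmem s).2 ⟨t, ht, fun l => ?_, fun l hl => ?_⟩)
      · rcases eq_or_ne l c with rfl | hl
        · exact not_lt.1 hle
        · exact (htc.1 l).trans (hne l hl).le
      · rw [← htc.2 l hl, hne l]
        rintro rfl
        exact hl (hcm t htc.1)
    convert ht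
    ext l
    rcases lt_trichotomy l c with hl | rfl | hl
    -- Since x_c divides t, variables before x_c are not multiplicative for t, so their exponents
    -- must agree.
    · refine htc.2 l fun hlm => ?_
      have h3 : cls t ≤ (l : ℕ) + 1 := hlm
      have h4 := le_cls (μ := t) (l := c) (by omega)
      rw [Fin.lt_def] at hl
      omega
    · have := htc.1 l
      omega
    · rw [Fin.lt_def] at hl
      rw [hsc l hl]
      exact (Nat.le_zero.1 ((htc.1 l).trans (hsc l hl).le)).symm
  · intro ht
    refine ⟨fun h => ?_, (hmem _).2 ⟨_, ht, self_mem_coneExponents _⟩⟩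
    obtain ⟨t', ht', htc'⟩ := (hmem _).1 h
    have hle : s ≤ s + Finsupp.single c 1 := le_self_add
    -- A cone containing s also contains x_c s; disjointness forces its generator t' to be x_c s,
    -- which does not divide s.
    have heq := hT.eq_of_mem_coneExponents ht ht' (self_mem_coneExponents _)
      ⟨htc'.1.trans hle, fun l hl => by
        rw [hne l, htc'.2 l hl]
        rintro rfl
        exact hl (hcm t' (htc'.1.trans hle))⟩
    have := htc'.1 c
    rw [← heq] at this
    omega

theorem add_single_injective (c : Fin n) :
    Function.Injective fun s : Fin n →₀ ℕ => s + Finsupp.single c 1 :=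
  add_left_injective _

theorem ncard_standard_becoming_nonstandard (hT : IsMonomialPommaretBasis T (leadingIdeal I))
    (c : Fin n) (j : ℕ) :
    {s : Fin n →₀ ℕ | s.degree = j ∧ s ∈ standardExponents I (c + 1) ∧
      s + Finsupp.single c 1 ∈ leadingExponents I}.ncard =
    (T.filter fun t => cls t = c + 1 ∧ t.degree = j + 1).card := by
  rw [← Set.ncard_coe_finset, ← Set.ncard_image_of_injective _ (add_single_injective c)]
  congr 1
  ext t
  rw [Finset.mem_coe, Finset.mem_filter]
  constructor
  · rintro ⟨s, ⟨hd, hs, hl⟩, rfl⟩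
    refine ⟨(notMem_and_add_single_mem_iff hT hs.1).1 ⟨hs.2, hl⟩, ?_, by simp [hd]⟩
    refine le_antisymm (cls_le_iff.2 fun l hl => ?_) (le_cls (by simp))
    have : l ≠ c := by rintro rfl; omega
    simp [hs.1 l hl, Finsupp.single_eq_of_ne this]
  · rintro ⟨ht, hc, hd⟩
    have h0 : t c ≠ 0 := apply_ne_zero_of_cls_eq hc (by rintro rfl; simp at hd)
    have hle : Finsupp.single c 1 ≤ t := by
      rw [Finsupp.single_le_iff]
      omega
    obtain ⟨s, rfl⟩ := le_iff_exists_add'.1 hle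
    have hs : ∀ l : Fin n, (c : ℕ) + 1 ≤ l → s l = 0 := fun l hl => by
      have := cls_le_iff.1 hc.le l hl
      rw [Finsupp.add_apply] at this
      omega
    obtain ⟨h1, h2⟩ := (notMem_and_add_single_mem_iff hT hs).2 ht
    exact ⟨s, ⟨by simpa using hd, ⟨hs, h1⟩, h2⟩, rfl⟩

/-- Split the standard s of degree j by whether x_c s is standard. Multiplication by x_c maps those
for which it is bijectively onto the first set on the right, as divisors of standard monomials are
standard. -/
theorem ncard_standard_eq_add (I : Ideal (MvPolynomial (Fin n) k)) (c : Fin n) (j : ℕ) :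
    ({μ : Fin n →₀ ℕ | μ.degree = j} ∩ standardExponents I (c + 1)).ncard =
    ({μ : Fin n →₀ ℕ | μ.degree = j + 1 ∧ ∃ l : Fin n, (c : ℕ) ≤ l ∧ μ l ≠ 0} ∩
      standardExponents I (c + 1)).ncard +
    {s : Fin n →₀ ℕ | s.degree = j ∧ s ∈ standardExponents I (c + 1) ∧
      s + Finsupp.single c 1 ∈ leadingExponents I}.ncard := by
  have himage : {μ : Fin n →₀ ℕ | μ.degree = j + 1 ∧ ∃ l : Fin n, (c : ℕ) ≤ l ∧ μ l ≠ 0} ∩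
      standardExponents I (c + 1) = (fun s : Fin n →₀ ℕ => s + Finsupp.single c 1) ''
        {s : Fin n →₀ ℕ | s.degree = j ∧ s ∈ standardExponents I (c + 1) ∧
          s + Finsupp.single c 1 ∉ leadingExponents I} := by
    ext μ
    constructor
    · rintro ⟨⟨hd, l, hl, hne⟩, h0, hI⟩
      have hlc : l = c := by
        by_contra h
        exact hne (h0 l (by have : (l : ℕ) ≠ c := fun h' => h (Fin.ext h'); omega))
      subst hlc
      have hle : Finsupp.single l 1 ≤ μ := by
        rw [Finsupp.single_le_iff]
        omega
      obtain ⟨s, rfl⟩ := le_iff_exists_add'.1 hle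
      refine ⟨s, ⟨by simpa using hd, ⟨fun p hp => ?_, fun h => ?_⟩, hI⟩, rfl⟩
      · have := h0 p hp
        rw [Finsupp.add_apply] at this
        omega
      · exact hI (leadingExponents_of_le h le_self_add)
    · rintro ⟨s, ⟨hd, hs, hI⟩, rfl⟩
      refine ⟨⟨by simp [hd], c, le_rfl, by simp⟩, fun l hl => ?_, hI⟩
      have : l ≠ c := by rintro rfl; omega
      simp [hs.1 l hl, Finsupp.single_eq_of_ne this]
  rw [himage, Set.ncard_image_of_injective _ (add_single_injective c), ← Set.ncard_union_eq ?_
    ((Finsupp.finite_of_degree_eq j).subset fun s hs => hs.1)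
    ((Finsupp.finite_of_degree_eq j).subset fun s hs => hs.1)]
  · congr 1
    ext s
    by_cases h : s + Finsupp.single c 1 ∈ leadingExponents I <;> simp [h]
  · rw [Set.disjoint_left]
    rintro s ⟨-, -, h⟩ ⟨-, -, h'⟩
    exact h h'

end

end PommaretAnn

namespace PommaretAnn

open MvPolynomial
open scoped MonomialOrder

section

variable {k : Type*} [Field k] {n : ℕ}

/-! ### Annihilators -/

/-- The projection of the polynomial ring onto `M / ⟨y_1, …, y_i⟩ M`. -/
noncomputable def seqQuotientMk (I : Ideal (MvPolynomial (Fin n) k)) {m : ℕ}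
    (y : Fin m → MvPolynomial (Fin n) k) (i : Fin m) :
    MvPolynomial (Fin n) k →ₗ[MvPolynomial (Fin n) k] SeqQuotient I y i :=
  (Submodule.mkQ (Ideal.span (y '' Set.Iio i) •
    (⊤ : Submodule (MvPolynomial (Fin n) k) (MvPolynomial (Fin n) k ⧸ I)))).comp
      (Submodule.mkQ I)

theorem ker_seqQuotientMk (I : Ideal (MvPolynomial (Fin n) k)) {m : ℕ}
    (y : Fin m → MvPolynomial (Fin n) k) (i : Fin m) :
    LinearMap.ker (seqQuotientMk I y i) = I ⊔ Ideal.span (y '' Set.Iio i) := by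
  have htop : (⊤ : Submodule (MvPolynomial (Fin n) k) (MvPolynomial (Fin n) k ⧸ I)) =
      Submodule.map (Submodule.mkQ I) ⊤ := by
    rw [Submodule.map_top, Submodule.range_mkQ]
  rw [seqQuotientMk, LinearMap.ker_comp, Submodule.ker_mkQ, htop, ← Submodule.map_smul'',
    Submodule.comap_map_mkQ, smul_eq_mul, Ideal.mul_top]

theorem seqQuotientMk_reversedVars_eq_zero_iff (I : Ideal (MvPolynomial (Fin n) k)) (i : Fin n)
    (f : MvPolynomial (Fin n) k) :
    seqQuotientMk I (reversedVars k n) i f = 0 ↔ f ∈ trailingIdeal I (Fin.rev i + 1) := by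
  have himage : reversedVars k n '' Set.Iio i =
      X '' {l : Fin n | ((Fin.rev i : Fin n) : ℕ) + 1 ≤ l} := by
    ext p
    constructor
    · rintro ⟨l, hl, rfl⟩
      exact ⟨Fin.rev l, Fin.lt_def.1 (Fin.rev_lt_rev.2 hl), rfl⟩
    · rintro ⟨l, hl, rfl⟩
      refine ⟨Fin.rev l, ?_, by simp [reversedVars]⟩
      rw [Set.mem_Iio, ← Fin.rev_lt_rev, Fin.rev_rev]
      exact hl
  rw [← LinearMap.mem_ker, ker_seqQuotientMk, himage, trailingIdeal]

theorem homogeneousSubmodule_eq_restrictSupport (n j : ℕ) :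
    homogeneousSubmodule (Fin n) k j = restrictSupport k {μ | μ.degree = j} :=
  homogeneousSubmodule_eq_finsupp_supported ..

theorem seqQuotientComponent_eq_map (I : Ideal (MvPolynomial (Fin n) k)) {m : ℕ}
    (y : Fin m → MvPolynomial (Fin n) k) (i : Fin m) (j : ℕ) :
    seqQuotientComponent I y i j =
      (restrictSupport k {μ | μ.degree = j}).map ((seqQuotientMk I y i).restrictScalars k) := by
  rw [← homogeneousSubmodule_eq_restrictSupport]
  rfl

theorem finite_seqQuotientComponent (I : Ideal (MvPolynomial (Fin n) k)) {m : ℕ}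
    (y : Fin m → MvPolynomial (Fin n) k) (i : Fin m) (j : ℕ) :
    Module.Finite k (seqQuotientComponent I y i j) := by
  rw [seqQuotientComponent_eq_map, restrictSupport_eq_span, Submodule.map_span]
  exact Module.Finite.span_of_finite k
    (((Finsupp.finite_of_degree_eq j).image _).image _)

/-- Multiplication by `y_{i+1}` on `M / ⟨y_1, …, y_i⟩ M`, as a `k`-linear map. -/
noncomputable def seqQuotientMul (I : Ideal (MvPolynomial (Fin n) k)) {m : ℕ}
    (y : Fin m → MvPolynomial (Fin n) k) (i : Fin m) :
    SeqQuotient I y i →ₗ[k] SeqQuotient I y i :=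
  (LinearMap.lsmul (MvPolynomial (Fin n) k) (SeqQuotient I y i) (y i)).restrictScalars k

theorem annihilatorNumber_add_finrank_map (I : Ideal (MvPolynomial (Fin n) k)) {m : ℕ}
    (y : Fin m → MvPolynomial (Fin n) k) (i : Fin m) (j : ℕ) :
    annihilatorNumber I y i j +
      Module.finrank k ((seqQuotientComponent I y i j).map (seqQuotientMul I y i)) =
    Module.finrank k (seqQuotientComponent I y i j) := by
  have hker : (LinearMap.ker ((seqQuotientMul I y i).domRestrict
      (seqQuotientComponent I y i j))).map (seqQuotientComponent I y i j).subtype =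
      annComponent I y i j := by
    ext w
    simp only [Submodule.mem_map, LinearMap.mem_ker, LinearMap.domRestrict_apply,
      Submodule.subtype_apply, annComponent, Submodule.mem_inf]
    constructor
    · rintro ⟨w, hw, rfl⟩
      exact ⟨hw, w.2⟩
    · rintro ⟨hw, hw'⟩
      exact ⟨⟨w, hw'⟩, hw, rfl⟩
  have := finite_seqQuotientComponent I y i j
  rw [← LinearMap.finrank_range_add_finrank_ker
    ((seqQuotientMul I y i).domRestrict (seqQuotientComponent I y i j)), add_comm,
    LinearMap.range_domRestrict, add_right_inj, annihilatorNumber,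
    ← hker, Submodule.finrank_map_subtype_eq]

/-- Monomials in the later variables vanish in the quotient. Admitting them costs nothing and makes
the exponent set closed downwards, as the dimension count requires. -/
theorem map_seqQuotientMul_reversedVars (I : Ideal (MvPolynomial (Fin n) k)) (i : Fin n)
    (j : ℕ) :
    (seqQuotientComponent I (reversedVars k n) i j).map
        (seqQuotientMul I (reversedVars k n) i) =
      (restrictSupport k
        {μ | μ.degree = j + 1 ∧ ∃ l : Fin n, ((Fin.rev i : Fin n) : ℕ) ≤ l ∧ μ l ≠ 0}).map
        ((seqQuotientMk I (reversedVars k n) i).restrictScalars k) := by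
  have hmul : ∀ μ : Fin n →₀ ℕ,
      seqQuotientMul I (reversedVars k n) i (seqQuotientMk I (reversedVars k n) i
        (monomial μ 1)) = seqQuotientMk I (reversedVars k n) i
          (monomial (μ + Finsupp.single (Fin.rev i) 1) 1) := by
    intro μ
    rw [monomial_add_single, pow_one, mul_comm, ← smul_eq_mul, map_smul]
    rfl
  rw [seqQuotientComponent_eq_map, restrictSupport_eq_span, restrictSupport_eq_span,
    Submodule.map_span, Submodule.map_span, Submodule.map_span]
  apply le_antisymm
  · rw [Submodule.span_le]
    rintro _ ⟨_, ⟨_, ⟨μ, hμ, rfl⟩, rfl⟩, rfl⟩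
    have hd : μ.degree = j := hμ
    exact Submodule.subset_span
      ⟨_, ⟨_, ⟨by simp [hd], Fin.rev i, le_rfl, by simp⟩, rfl⟩, (hmul μ).symm⟩
  · rw [Submodule.span_le]
    rintro _ ⟨_, ⟨μ, ⟨hd, l, hl, hne⟩, rfl⟩, rfl⟩
    by_cases h : ∃ l : Fin n, ((Fin.rev i : Fin n) : ℕ) + 1 ≤ l ∧ μ l ≠ 0
    · have h0 : seqQuotientMk I (reversedVars k n) i (monomial μ 1) = 0 :=
        (seqQuotientMk_reversedVars_eq_zero_iff I i _).2 (monomial_mem_trailingIdeal I h 1)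
      rw [LinearMap.restrictScalars_apply, h0]
      exact Submodule.zero_mem _
    · push Not at h
      have hli : l = Fin.rev i := by
        by_contra hc
        have : (l : ℕ) ≠ Fin.rev i := fun h' => hc (Fin.ext h')
        exact hne (h l (by omega))
      subst hli
      have hle : Finsupp.single (Fin.rev i) 1 ≤ μ := by
        rw [Finsupp.single_le_iff]
        omega
      obtain ⟨s, rfl⟩ := le_iff_exists_add'.1 hle
      exact Submodule.subset_span
        ⟨_, ⟨_, ⟨s, by simpa using hd, rfl⟩, rfl⟩, hmul s⟩

/-! ### Annihilator numbers and quasi-regularity -/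

theorem annihilatorNumber_reversedVars {I : Ideal (MvPolynomial (Fin n) k)}
    (hI : I.IsHomogeneous (homogeneousSubmodule (Fin n) k))
    {T : Finset (Fin n →₀ ℕ)} (hT : IsMonomialPommaretBasis T (leadingIdeal I))
    (i : Fin n) (j : ℕ) :
    annihilatorNumber I (reversedVars k n) i j =
      (T.filter fun t => cls t = Fin.rev i + 1 ∧ t.degree = j + 1).card := by
  have hsum := annihilatorNumber_add_finrank_map I (reversedVars k n) i j
  rw [map_seqQuotientMul_reversedVars, seqQuotientComponent_eq_map,
    finrank_map_restrictSupport hI _ (seqQuotientMk_reversedVars_eq_zero_iff I i) (j := j)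
      (E := {μ | μ.degree = j}) (fun _ h => h) (fun μ hμ ν hd _ => hd.trans hμ),
    finrank_map_restrictSupport hI _ (seqQuotientMk_reversedVars_eq_zero_iff I i) (j := j + 1)
      (E := {μ | μ.degree = j + 1 ∧ ∃ l : Fin n, ((Fin.rev i : Fin n) : ℕ) ≤ l ∧ μ l ≠ 0})
      (fun _ h => h.1), ncard_standard_eq_add,
    ncard_standard_becoming_nonstandard hT] at hsum
  · omega
  · rintro μ ⟨hd, hl⟩ ν hνd hlt
    refine ⟨hνd.trans hd, ?_⟩
    -- If ν avoided x_c and all later variables while μ does not, ν would be the larger one.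
    by_contra h
    push Not at h
    exact (degRevLex_lt_of_trailing hνd.symm h hl).asymm hlt

theorem IsPommaretBasis.annihilatorNumber_eq {I : Ideal (MvPolynomial (Fin n) k)}
    (hI : I.IsHomogeneous (homogeneousSubmodule (Fin n) k))
    {H : Finset (MvPolynomial (Fin n) k)} (hH : IsPommaretBasis H I) (i : Fin n) (j : ℕ) :
    annihilatorNumber I (reversedVars k n) i j =
      (H.filter fun h => cls (lt h) = n - (i : ℕ) ∧ h.totalDegree = j + 1).card := by
  have hi : ((Fin.rev i : Fin n) : ℕ) + 1 = n - i := by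
    rw [Fin.val_rev]
    omega
  rw [annihilatorNumber_reversedVars hI hH.lt_basis, hi, Finset.filter_image,
    Finset.card_image_of_injOn
      (hH.lt_injOn.mono (Finset.coe_subset.2 (Finset.filter_subset _ _)))]
  simp_rw [totalDegree_eq_degree_lt]

theorem IsPommaretBasis.isQuasiRegular {I : Ideal (MvPolynomial (Fin n) k)}
    (hI : I.IsHomogeneous (homogeneousSubmodule (Fin n) k))
    {H : Finset (MvPolynomial (Fin n) k)} (hH : IsPommaretBasis H I) :
    IsQuasiRegular I (reversedVars k n) := by
  refine ⟨fun i => isHomogeneous_X _ _, fun i => ?_⟩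
  refine (H.image fun h => h.totalDegree - 1).finite_toSet.subset fun j hj => ?_
  have := finite_seqQuotientComponent I (reversedVars k n) i j
  -- Finite dimensionality is needed because `finrank` also takes the value 0 on
  -- infinite-dimensional spaces.
  have hfin : Module.Finite k (annComponent I (reversedVars k n) i j) :=
    Submodule.finiteDimensional_of_le inf_le_right
  have hne : annihilatorNumber I (reversedVars k n) i j ≠ 0 := fun h =>
    hj (Submodule.finrank_eq_zero.1 h)
  rw [hH.annihilatorNumber_eq hI, Finset.card_ne_zero] at hne
  obtain ⟨h, hh⟩ := hne
  rw [Finset.mem_filter] at hh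
  rw [Finset.mem_coe, Finset.mem_image]
  exact ⟨h, hh.1, by omega⟩

end

end PommaretAnn

theorem mainTheorem4 {k : Type*} [Field k] (n : ℕ)
    (I : Ideal (MvPolynomial (Fin n) k))
    (hI : I.IsHomogeneous (MvPolynomial.homogeneousSubmodule (Fin n) k))
    (H : Finset (MvPolynomial (Fin n) k))
    (hH : PommaretAnn.IsPommaretBasis H I) :
    PommaretAnn.IsQuasiRegular I (PommaretAnn.reversedVars k n) ∧
      ∀ (i : Fin n) (j : ℕ),
        PommaretAnn.annihilatorNumber I (PommaretAnn.reversedVars k n) i j =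
          (H.filter fun h =>
            PommaretAnn.cls (PommaretAnn.lt h) = n - (i : ℕ) ∧ h.totalDegree = j + 1).card :=
  ⟨hH.isQuasiRegular hI, hH.annihilatorNumber_eq hI⟩
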